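/- Let $\sigma>0$, and let $W,\gamma:\mathbb{R}\to\mathbb{R}$ be $C^\infty$ functions that decay exponentially, i.e. $|W(x)|\le Ce^{-\alpha|x|}$ for some constants $C$ and $\alpha>0$, and similarly for $\gamma$ (with possibly different constants); assume that $\gamma$ is odd. Let $$\mathcal H=-\partial_x^2-W(x)+\sigma^2$$ be the Schrödinger operator on the complex space $L^2(\mathbb{R})$ with domain $H^2(\mathbb{R})$, and assume that its point spectrum (set of eigenvalues) consists of finitely many real numbers $$0=\sigma_0<\sigma_1^2<\cdots<\sigma_n^2<\sigma^2,\qquad n\ge 0 .$$ Let $\psi_0\in H^2(\mathbb{R})$, $\psi_0\ne0$, be an eigenfunction of $\mathcal H$ for the eigenvalue $0$, i.e. $\mathcal H\psi_0=0$. For $\epsilon>0$ consider the operator $$\mathcal L=\begin{pmatrix}0&1\\-\mathcal H&-\epsilon\gamma(x)\end{pmatrix},\qquad \mathcal L\binom{v}{w}=\binom{w}{-\mathcal Hv-\epsilon\gamma w},$$ on $L^2(\mathbb{R})\times L^2(\mathbb{R})$ with domain $H^2(\mathbb{R})\times L^2(\mathbb{R})$, and write $\langle f,g\rangle=\int_{-\infty}^{\infty}f(x)g(x)\,dx$.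 The algebraic multiplicity of the eigenvalue $0$ of $\mathcal L$ is the dimension of its generalized kernel $\bigcup_{k\ge1}\ker\mathcal L^k$ (each power taken with its natural domain). Then there is an $\epsilon_0>0$ such that, for every $\epsilon\in(0,\epsilon_0)$, the number $0$ is an eigenvalue of $\mathcal L$; its algebraic multiplicity is two if $\langle\gamma\psi_0,\psi_0\rangle=0$, and one if $\langle\gamma\psi_0,\psi_0\rangle\neq0$. -/

import Mathlib

open MeasureTheory Set
open scoped ENNReal ContDiff LineDeriv

noncomputable section

namespace PTKleinGordon

/-- The complex Hilbert space `L²(ℝ)`. -/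
abbrev L2 : Type := Lp ℂ 2 (volume : Measure ℝ)

/-- A smooth real function on the line which decays exponentially fast:
`|W x| ≤ C * exp (-α * |x|)` for some `C` and some `α > 0`. -/
structure ExpLocalized (W : ℝ → ℝ) : Prop where
  smooth : ContDiff ℝ ∞ W
  decay : ∃ C α : ℝ, 0 < α ∧ ∀ x : ℝ, |W x| ≤ C * Real.exp (-α * |x|)

theorem ExpLocalized.memLp_top {W : ℝ → ℝ} (hW : ExpLocalized W) :
    MemLp (fun x : ℝ => (W x : ℂ)) ∞ (volume : Measure ℝ) := by
  obtain ⟨C, α, hα, h⟩ := hW.decay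
  refine memLp_top_of_bound
    (Complex.continuous_ofReal.comp hW.smooth.continuous).aestronglyMeasurable C
    (Filter.Eventually.of_forall fun x => ?_)
  have hC : 0 ≤ C := by
    have h0 := (abs_nonneg _).trans (h 0)
    simpa using h0
  have h1 : Real.exp (-α * |x|) ≤ 1 := by
    rw [Real.exp_le_one_iff]
    nlinarith [abs_nonneg x]
  rw [Complex.norm_real, Real.norm_eq_abs]
  exact (h x).trans (mul_le_of_le_one_right hC h1)

/-- The multiplication operator `u ↦ W u` on `L²(ℝ)`. -/
def mulOp {W : ℝ → ℝ} (hW : ExpLocalized W) : L2 →ₗ[ℂ] L2 where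
  toFun u := (hW.memLp_top.toLp _ : Lp ℂ ∞ (volume : Measure ℝ)) • u
  map_add' u v := Lp.add_smul _ u v
  map_smul' c u := (Lp.smul_comm c _ u).symm

theorem mulOp_coeFn {W : ℝ → ℝ} (hW : ExpLocalized W) (u : L2) :
    ∀ᵐ x : ℝ, mulOp hW u x = (W x : ℂ) * u x := by
  filter_upwards [Lp.coeFn_lpSMul (r := 2) (hW.memLp_top.toLp _) u,
    hW.memLp_top.coeFn_toLp] with x h1 h2
  change ((hW.memLp_top.toLp _ : Lp ℂ ∞ (volume : Measure ℝ)) • u : L2) x = _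
  rw [h1, Pi.smul_apply', h2, smul_eq_mul]

/-- The inclusion of `L²(ℝ)` into the tempered distributions. -/
abbrev toDistr : L2 →ₗ[ℂ] TemperedDistribution ℝ ℂ :=
  (Lp.toTemperedDistributionCLM ℂ (volume : Measure ℝ) 2).toLinearMap

/-- The Sobolev space `H²(ℝ)`, as a subspace of `L²(ℝ)`. -/
def sobolevH2 : Submodule ℂ L2 where
  carrier := {u | TemperedDistribution.MemSobolev 2 2 (toDistr u)}
  zero_mem' := by
    change TemperedDistribution.MemSobolev 2 2 (toDistr 0)
    rw [map_zero]
    exact TemperedDistribution.memSobolev_fun_zero ℝ ℂ 2 2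
  add_mem' {u v} hu hv := by
    change TemperedDistribution.MemSobolev 2 2 (toDistr (u + v))
    rw [map_add]
    exact TemperedDistribution.MemSobolev.add hu hv
  smul_mem' c u hu := by
    change TemperedDistribution.MemSobolev 2 2 (toDistr (c • u))
    rw [map_smul]
    exact TemperedDistribution.MemSobolev.smul c hu

theorem toDistr_injective : Function.Injective toDistr :=
  LinearMap.ker_eq_bot.mp Lp.ker_toTemperedDistributionCLM_eq_bot

theorem exists_secondDeriv (u : sobolevH2) :
    ∃ f : L2, toDistr f = ∂_{(1 : ℝ)} (∂_{(1 : ℝ)} (toDistr u)) := by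
  have hu : TemperedDistribution.MemSobolev 2 2 (toDistr u) := u.2
  have h2 := (hu.lineDerivOp (m := (1 : ℝ))).lineDerivOp (m := (1 : ℝ))
  have h0 : (2 - 1 - 1 : ℝ) = 0 := by norm_num
  rw [h0, TemperedDistribution.memSobolev_zero_iff] at h2
  obtain ⟨f, hf⟩ := h2
  exact ⟨f, hf.symm⟩

/-- The second derivative `∂ₓ² : H²(ℝ) → L²(ℝ)`: the unique element of `L²(ℝ)` which represents
the second distributional derivative of `u`. -/
def secondDeriv : sobolevH2 →ₗ[ℂ] L2 where
  toFun u := (exists_secondDeriv u).choose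
  map_add' u v := by
    apply toDistr_injective
    rw [map_add, (exists_secondDeriv (u + v)).choose_spec, (exists_secondDeriv u).choose_spec,
      (exists_secondDeriv v).choose_spec, Submodule.coe_add, map_add,
      LineDeriv.lineDerivOp_add, LineDeriv.lineDerivOp_add]
  map_smul' c u := by
    apply toDistr_injective
    rw [map_smul, (exists_secondDeriv (c • u)).choose_spec, (exists_secondDeriv u).choose_spec,
      Submodule.coe_smul, map_smul, LineDeriv.lineDerivOp_smul,
      LineDeriv.lineDerivOp_smul, RingHom.id_apply]

theorem toDistr_secondDeriv (u : sobolevH2) :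
    toDistr (secondDeriv u) = ∂_{(1 : ℝ)} (∂_{(1 : ℝ)} (toDistr u)) :=
  (exists_secondDeriv u).choose_spec

/-- The Schrödinger operator `H = -∂ₓ² - W(x) + σ²` on `L²(ℝ)` with domain `H²(ℝ)`. -/
def schrodinger {W : ℝ → ℝ} (hW : ExpLocalized W) (σ : ℝ) : L2 →ₗ.[ℂ] L2 where
  domain := sobolevH2
  toFun := -secondDeriv - (mulOp hW).comp sobolevH2.subtype
    + ((σ : ℂ) ^ 2) • sobolevH2.subtype

/-- The operator matrix `L = [[0, 1], [-H, -εγ]]` on `L²(ℝ) × L²(ℝ)`, with domain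
`H²(ℝ) × L²(ℝ)`; that is `L (v, w) = (w, -H v - ε γ w)`. -/
def linearization {W γ : ℝ → ℝ} (hW : ExpLocalized W) (hγ : ExpLocalized γ) (σ ε : ℝ) :
    (L2 × L2) →ₗ.[ℂ] (L2 × L2) where
  domain := (schrodinger hW σ).domain.prod ⊤
  toFun :=
    { toFun := fun p =>
        (p.1.2, -(schrodinger hW σ ⟨p.1.1, p.2.1⟩) - (ε : ℂ) • mulOp hγ p.1.2)
      map_add' := fun p q => by
        have h : (⟨(p + q).1.1, (p + q).2.1⟩ : (schrodinger hW σ).domain)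
            = ⟨p.1.1, p.2.1⟩ + ⟨q.1.1, q.2.1⟩ := rfl
        rw [h, LinearPMap.map_add]
        ext1
        · rfl
        · simp only [Submodule.coe_add, Prod.snd_add, map_add, smul_add]
          abel
      map_smul' := fun c p => by
        have h : (⟨(c • p).1.1, (c • p).2.1⟩ : (schrodinger hW σ).domain)
            = c • ⟨p.1.1, p.2.1⟩ := rfl
        rw [h, LinearPMap.map_smul]
        ext1
        · rfl
        · simp only [Submodule.coe_smul, Prod.smul_snd, map_smul, RingHom.id_apply, smul_sub,
            smul_neg, smul_comm c (ε : ℂ)] }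

section Spectral

variable {E : Type*} [AddCommGroup E] [Module ℂ E]

/-- The point spectrum (the set of eigenvalues) of an operator with a domain. -/
def pointSpectrum (T : E →ₗ.[ℂ] E) : Set ℂ :=
  {μ | ∃ x : T.domain, (x : E) ≠ 0 ∧ T x = μ • (x : E)}

/-- `genKer T μ k` is the kernel of `(T - μ) ^ k`, with its natural domain: it is zero for `k = 0`,
and `x` lies in `genKer T μ (k + 1)` when `x` is in the domain of `T` and `T x - μ x` lies in
`genKer T μ k`. -/
def genKer (T : E →ₗ.[ℂ] E) (μ : ℂ) : ℕ → Submodule ℂ E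
  | 0 => ⊥
  | k + 1 => ((genKer T μ k).comap (T.toFun - μ • T.domain.subtype)).map T.domain.subtype

theorem mem_genKer_succ (T : E →ₗ.[ℂ] E) (μ : ℂ) (k : ℕ) (x : E) :
    x ∈ genKer T μ (k + 1) ↔ ∃ h : x ∈ T.domain, T ⟨x, h⟩ - μ • x ∈ genKer T μ k := by
  simp only [genKer, Submodule.mem_map, Submodule.mem_comap]
  constructor
  · rintro ⟨y, hy, rfl⟩
    exact ⟨y.2, hy⟩
  · rintro ⟨h, hx⟩
    exact ⟨⟨x, h⟩, hx, rfl⟩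

/-- The algebraic multiplicity of `μ`: the dimension (possibly infinite) of the generalized
eigenspace, the union of the kernels of the powers of `T - μ`. -/
def algMultiplicity (T : E →ₗ.[ℂ] E) (μ : ℂ) : ℕ∞ :=
  Cardinal.toENat (Module.rank ℂ (⨆ k : ℕ, genKer T μ k : Submodule ℂ E))

end Spectral

/-- The spectral assumption on an operator `T`: its point spectrum consists of finitely many real
numbers `0 = s 0 < s 1 < ⋯ < s n < σ²`. -/
def SpectralAssumption (T : L2 →ₗ.[ℂ] L2) (σ : ℝ) : Prop :=
  ∃ (n : ℕ) (s : Fin (n + 1) → ℝ), StrictMono s ∧ s 0 = 0 ∧ s (Fin.last n) < σ ^ 2 ∧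
    pointSpectrum T = range fun j => (s j : ℂ)

end PTKleinGordon

end

/-!
Write `H = -∂ₓ² - W + σ²`, `L` for the operator matrix, and `ψ` for the eigenfunction. A vector
`(v, w)` satisfies `L (v, w) = (a, b)` exactly when `w = a` and `H v = -b - ε γ a`, so Jordan
chains of `L` at `0` are obtained by solving equations `H v = f`. Three properties of `H` suffice.

* `inner_schrodinger`: `H` is symmetric, so its range is orthogonal to `ψ`. Here
  `-∂ₓ² + σ²` is inverted on `L²` by a Fourier multiplier `freeResolvent`, which is visibly
  symmetric.
* `exists_eq_smul_of_ker`: the kernel of `H` is `ℂ ψ`. Kernel elements are represented by classical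
  solutions of `U'' = (σ² - W) U` (du Bois-Reymond lemma); the Wronskian of two of them is constant
  and integrable, hence zero, and uniqueness for the initial value problem makes them proportional.
  Applied to `ψ` and its conjugate, this also shows that `∫ γ ψ²` vanishes exactly when the
  inner product `⟪ψ, γ ψ⟫` does.
* `exists_schrodinger_eq`: every `f` orthogonal to `ψ` is of the form `H v`. The
  operator `W (-∂ₓ² + σ²)⁻¹` has a square-integrable kernel, so it is compact, and the
  Fredholm alternative applies to the injective operator `H + ⟪ψ, ·⟫ ψ`.

The kernel of `L` is therefore spanned by `(ψ, 0)`. A second chain vector `(v, ψ)` requires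
`H v = -ε γ ψ`, which is solvable if and only if `⟪ψ, γ ψ⟫ = 0`
(`algMultiplicity_eq_one`). If it is, with `H v = γ ψ`, the second vector is `(-ε v, ψ)` up to a
multiple of `(ψ, 0)`, and a third one would require `‖ψ‖² = ε² ⟪ψ, γ v⟫`, which fails for small `ε`
(`algMultiplicity_eq_two`).
-/

noncomputable section

namespace PTKleinGordon

open TemperedDistribution FourierTransform
open scoped InnerProductSpace Real

/-! ### Multiplication operators on `L²(ℝ)` -/

/-- Multiplication by a bounded function, as a bounded operator on `L²(ℝ)`. -/
def mulCLM (w : Lp ℂ ∞ (volume : Measure ℝ)) : L2 →L[ℂ] L2 :=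
  LinearMap.mkContinuous
    { toFun := fun u => w • u
      map_add' := fun u v => Lp.add_smul _ u v
      map_smul' := fun c u => (Lp.smul_comm c _ u).symm } ‖w‖
    (fun u => Lp.norm_smul_le w u)

theorem mulCLM_apply (w : Lp ℂ ∞ (volume : Measure ℝ)) (u : L2) : mulCLM w u = w • u := rfl

theorem mulCLM_coeFn {w : ℝ → ℂ} (hw : MemLp w ∞ (volume : Measure ℝ)) (u : L2) :
    ∀ᵐ x : ℝ, mulCLM (hw.toLp w) u x = w x * u x := by
  filter_upwards [Lp.coeFn_lpSMul (r := 2) (hw.toLp w) u, hw.coeFn_toLp] with x h1 h2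
  rw [mulCLM_apply, h1, Pi.smul_apply', h2, smul_eq_mul]

/-- Multiplication by a bounded real function is symmetric. -/
theorem inner_mulCLM {w : ℝ → ℝ} (hw : MemLp (fun x => (w x : ℂ)) ∞ (volume : Measure ℝ))
    (u v : L2) : ⟪mulCLM (hw.toLp _) u, v⟫_ℂ = ⟪u, mulCLM (hw.toLp _) v⟫_ℂ := by
  rw [L2.inner_def, L2.inner_def]
  refine integral_congr_ae ?_
  filter_upwards [mulCLM_coeFn hw u, mulCLM_coeFn hw v] with x h1 h2
  simp only [h1, h2, RCLike.inner_apply, map_mul, Complex.conj_ofReal]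
  ring

theorem inner_mulOp {W : ℝ → ℝ} (hW : ExpLocalized W) (u v : L2) :
    ⟪mulOp hW u, v⟫_ℂ = ⟪u, mulOp hW v⟫_ℂ :=
  inner_mulCLM hW.memLp_top u v

/-! ### The free resolvent -/

/-- The Fourier symbol `(σ² + (2πξ)²)⁻¹` of the free resolvent `(-∂ₓ² + σ²)⁻¹`. -/
def resolventSymbol (σ ξ : ℝ) : ℝ := (σ ^ 2 + (2 * π * ξ) ^ 2)⁻¹

theorem resolventSymbol_nonneg (σ ξ : ℝ) : 0 ≤ resolventSymbol σ ξ := by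
  unfold resolventSymbol; positivity

theorem resolventSymbol_le {σ : ℝ} (hσ : 0 < σ) (ξ : ℝ) : resolventSymbol σ ξ ≤ (σ ^ 2)⁻¹ := by
  unfold resolventSymbol
  gcongr
  nlinarith [sq_nonneg (2 * π * ξ)]

theorem hasTemperateGrowth_resolventSymbol {σ : ℝ} (hσ : 0 < σ) :
    (resolventSymbol σ).HasTemperateGrowth := by
  have h1 : (fun ξ : ℝ => (1 + ‖ξ‖ ^ 2) ^ (-1 : ℝ)).HasTemperateGrowth := by fun_prop
  have h2 : (fun ξ : ℝ => (2 * π / σ) * ξ).HasTemperateGrowth := by fun_prop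
  have h3 := (Function.HasTemperateGrowth.const (E := ℝ) ((σ ^ 2)⁻¹)).mul (h1.comp h2)
  refine (?_ : resolventSymbol σ = _) ▸ h3
  funext ξ
  simp only [resolventSymbol, Pi.mul_apply, Function.comp_apply, Real.rpow_neg_one,
    Real.norm_eq_abs, sq_abs]
  rw [← mul_inv]
  congr 1
  field_simp

theorem hasTemperateGrowth_resolventSymbol_ofReal {σ : ℝ} (hσ : 0 < σ) :
    (fun ξ => (resolventSymbol σ ξ : ℂ)).HasTemperateGrowth :=
  Function.Complex.hasTemperateGrowth_ofReal.comp (hasTemperateGrowth_resolventSymbol hσ)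

theorem memLp_top_resolventSymbol {σ : ℝ} (hσ : 0 < σ) :
    MemLp (fun ξ => (resolventSymbol σ ξ : ℂ)) ∞ (volume : Measure ℝ) := by
  refine memLp_top_of_bound
    (hasTemperateGrowth_resolventSymbol_ofReal hσ).1.continuous.aestronglyMeasurable
    ((σ ^ 2)⁻¹) (Filter.Eventually.of_forall fun ξ => ?_)
  rw [Complex.norm_real, Real.norm_eq_abs, abs_of_nonneg (resolventSymbol_nonneg σ ξ)]
  exact resolventSymbol_le hσ ξ

/-- Multiplication by the resolvent symbol on the Fourier side. -/
def symbolOp {σ : ℝ} (hσ : 0 < σ) : L2 →L[ℂ] L2 :=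
  mulCLM ((memLp_top_resolventSymbol hσ).toLp _)

/-- The free resolvent `(-∂ₓ² + σ²)⁻¹` on `L²(ℝ)`, defined through the Fourier transform. -/
def freeResolvent {σ : ℝ} (hσ : 0 < σ) : L2 →L[ℂ] L2 :=
  (fourierInvCLM ℂ L2).comp ((symbolOp hσ).comp (fourierCLM ℂ L2))

theorem freeResolvent_apply {σ : ℝ} (hσ : 0 < σ) (g : L2) :
    freeResolvent hσ g = 𝓕⁻ (symbolOp hσ (𝓕 g)) := rfl

theorem inner_freeResolvent {σ : ℝ} (hσ : 0 < σ) (f g : L2) :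
    ⟪freeResolvent hσ f, g⟫_ℂ = ⟪f, freeResolvent hσ g⟫_ℂ := by
  rw [← Lp.inner_fourier_eq, ← Lp.inner_fourier_eq f, freeResolvent_apply, freeResolvent_apply,
    fourier_fourierInv_eq, fourier_fourierInv_eq]
  exact inner_mulCLM (memLp_top_resolventSymbol hσ) _ _

theorem toDistr_freeResolvent {σ : ℝ} (hσ : 0 < σ) (g : L2) :
    toDistr (freeResolvent hσ g)
      = fourierMultiplierCLM ℂ (fun ξ => (resolventSymbol σ ξ : ℂ)) (toDistr g) := by
  change Lp.toTemperedDistribution (freeResolvent hσ g)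
    = fourierMultiplierCLM ℂ (fun ξ => (resolventSymbol σ ξ : ℂ)) (Lp.toTemperedDistribution g)
  rw [freeResolvent_apply, ← Lp.fourierInv_toTemperedDistribution_eq, symbolOp, mulCLM_apply,
    Lp.toTemperedDistribution_smul_eq (hasTemperateGrowth_resolventSymbol_ofReal hσ),
    ← Lp.fourier_toTemperedDistribution_eq, fourierMultiplierCLM_apply]

theorem hasTemperateGrowth_symbol (σ : ℝ) :
    (fun ξ : ℝ => ((σ ^ 2 + (2 * π * ξ) ^ 2 : ℝ) : ℂ)).HasTemperateGrowth := by
  fun_prop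

/-- On tempered distributions, `-∂ₓ² + σ²` is the Fourier multiplier with symbol
`σ² + (2πξ)²`. -/
theorem neg_lineDerivOp_lineDerivOp_add (σ : ℝ) (T : TemperedDistribution ℝ ℂ) :
    -∂_{(1 : ℝ)} (∂_{(1 : ℝ)} T) + ((σ : ℂ) ^ 2) • T
      = fourierMultiplierCLM ℂ (fun ξ : ℝ => ((σ ^ 2 + (2 * π * ξ) ^ 2 : ℝ) : ℂ)) T := by
  have hid : (fun ξ : ℝ => ((inner ℝ ξ (1 : ℝ) : ℝ) : ℂ)).HasTemperateGrowth := by fun_prop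
  rw [lineDeriv_eq_fourierMultiplierCLM (1 : ℝ) (∂_{(1 : ℝ)} T),
    lineDeriv_eq_fourierMultiplierCLM (1 : ℝ) T, map_smul,
    fourierMultiplierCLM_fourierMultiplierCLM_apply hid hid]
  have h1 : (fun ξ : ℝ => ((σ ^ 2 + (2 * π * ξ) ^ 2 : ℝ) : ℂ))
      = ((σ : ℂ) ^ 2) • (fun _ : ℝ => (1 : ℂ)) +
        ((2 * π : ℂ) ^ 2) • ((fun ξ : ℝ => ((inner ℝ ξ (1 : ℝ) : ℝ) : ℂ)) *
          (fun ξ : ℝ => ((inner ℝ ξ (1 : ℝ) : ℝ) : ℂ))) := by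
    ext ξ
    simp
    ring
  have hc : (fun _ : ℝ => (1 : ℂ)).HasTemperateGrowth := by fun_prop
  have h2 : fourierMultiplierCLM ℂ (fun ξ : ℝ => ((σ ^ 2 + (2 * π * ξ) ^ 2 : ℝ) : ℂ)) T
      = ((σ : ℂ) ^ 2) • T + ((2 * π : ℂ) ^ 2) • fourierMultiplierCLM ℂ
        ((fun ξ : ℝ => ((inner ℝ ξ (1 : ℝ) : ℝ) : ℂ)) *
          (fun ξ : ℝ => ((inner ℝ ξ (1 : ℝ) : ℝ) : ℂ))) T := by
    rw [h1, fourierMultiplierCLM_apply]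
    rw [smulLeftCLM_add (by fun_prop) (by fun_prop), smulLeftCLM_smul (by fun_prop),
      smulLeftCLM_smul (by fun_prop)]
    simp only [add_apply, smul_apply,
      FourierTransform.fourierInv_add, FourierTransform.fourierInv_smul, smulLeftCLM_const,
      one_smul, fourierInv_fourier_eq, fourierMultiplierCLM_apply]
  rw [h2, smul_smul, add_comm]
  congr 1
  rw [← neg_smul]
  congr 1
  linear_combination (-(2 * π : ℂ) ^ 2) * Complex.I_sq

theorem symbol_mul_resolventSymbol {σ : ℝ} (hσ : 0 < σ) (ξ : ℝ) :
    ((σ ^ 2 + (2 * π * ξ) ^ 2 : ℝ) : ℂ) * (resolventSymbol σ ξ : ℂ) = 1 := by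
  have : σ ^ 2 + (2 * π * ξ) ^ 2 ≠ 0 := by positivity
  rw [← Complex.ofReal_mul, resolventSymbol, mul_inv_cancel₀ this, Complex.ofReal_one]

theorem freeResolvent_mem {σ : ℝ} (hσ : 0 < σ) (g : L2) : freeResolvent hσ g ∈ sobolevH2 := by
  change MemSobolev 2 2 (toDistr (freeResolvent hσ g))
  have hg : MemSobolev 0 2 (toDistr g) := memSobolev_zero_iff.2 ⟨g, rfl⟩
  have hm := hasTemperateGrowth_resolventSymbol_ofReal hσ
  have hb : (fun ξ : ℝ => (((1 + ‖ξ‖ ^ 2) ^ ((2 : ℝ) / 2) : ℝ) : ℂ)).HasTemperateGrowth := by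
    fun_prop
  have h20 : (2 : ℝ) = 2 + 0 := by norm_num
  rw [h20, ← memSobolev_besselPotential_iff, toDistr_freeResolvent, besselPotential,
    fourierMultiplierCLM_fourierMultiplierCLM_apply hm hb]
  refine hg.fourierMultiplierCLM_of_bounded (hm.mul hb) ⟨(σ ^ 2)⁻¹ + 1, fun ξ => ?_⟩
  have hpos : 0 < σ ^ 2 + (2 * π * ξ) ^ 2 := by positivity
  have hpi : 1 ≤ (2 * π) ^ 2 := by nlinarith [Real.pi_gt_three]
  have hξ : ξ ^ 2 ≤ (2 * π * ξ) ^ 2 := by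
    rw [mul_pow]; nlinarith [sq_nonneg ξ]
  have h3 : resolventSymbol σ ξ * ξ ^ 2 ≤ 1 := by
    unfold resolventSymbol
    rw [inv_mul_le_iff₀ hpos]
    nlinarith [sq_nonneg σ]
  simp only [Pi.mul_apply, ← Complex.ofReal_mul, Complex.norm_real, Real.norm_eq_abs, sq_abs]
  rw [div_self two_ne_zero, Real.rpow_one, abs_of_nonneg
    (mul_nonneg (resolventSymbol_nonneg σ ξ) (by positivity)), mul_add, mul_one]
  exact add_le_add (resolventSymbol_le hσ ξ) h3

/-- The free resolvent is a right inverse of `-∂ₓ² + σ²`. -/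
theorem freeOp_freeResolvent {σ : ℝ} (hσ : 0 < σ) (g : L2) :
    -secondDeriv ⟨freeResolvent hσ g, freeResolvent_mem hσ g⟩
      + ((σ : ℂ) ^ 2) • freeResolvent hσ g = g := by
  apply toDistr_injective
  rw [map_add, map_neg, map_smul, toDistr_secondDeriv]
  rw [neg_lineDerivOp_lineDerivOp_add, toDistr_freeResolvent,
    fourierMultiplierCLM_fourierMultiplierCLM_apply
      (hasTemperateGrowth_resolventSymbol_ofReal hσ) (hasTemperateGrowth_symbol σ)]
  have : ((fun ξ => (resolventSymbol σ ξ : ℂ)) * fun ξ : ℝ =>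
      ((σ ^ 2 + (2 * π * ξ) ^ 2 : ℝ) : ℂ)) = fun _ => 1 := by
    ext ξ
    rw [Pi.mul_apply, mul_comm, symbol_mul_resolventSymbol hσ]
  rw [this, fourierMultiplierCLM_const]
  simp

/-- The free resolvent is a left inverse of `-∂ₓ² + σ²`. -/
theorem freeResolvent_freeOp {σ : ℝ} (hσ : 0 < σ) (u : sobolevH2) :
    freeResolvent hσ (-secondDeriv u + ((σ : ℂ) ^ 2) • (u : L2)) = u := by
  apply toDistr_injective
  rw [toDistr_freeResolvent, map_add, map_neg, map_smul, toDistr_secondDeriv]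
  rw [neg_lineDerivOp_lineDerivOp_add,
    fourierMultiplierCLM_fourierMultiplierCLM_apply (hasTemperateGrowth_symbol σ)
      (hasTemperateGrowth_resolventSymbol_ofReal hσ)]
  have : ((fun ξ : ℝ => ((σ ^ 2 + (2 * π * ξ) ^ 2 : ℝ) : ℂ)) *
      fun ξ => (resolventSymbol σ ξ : ℂ)) = fun _ => 1 := by
    ext ξ
    rw [Pi.mul_apply, symbol_mul_resolventSymbol hσ]
  rw [this, fourierMultiplierCLM_const]
  simp

theorem schrodinger_apply {W : ℝ → ℝ} (hW : ExpLocalized W) (σ : ℝ)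
    (u : (schrodinger hW σ).domain) :
    schrodinger hW σ u
      = -secondDeriv u - mulOp hW (u : L2) + ((σ : ℂ) ^ 2) • (u : L2) := rfl

/-- The Schrödinger operator is symmetric. -/
theorem inner_schrodinger {W : ℝ → ℝ} (hW : ExpLocalized W) {σ : ℝ} (hσ : 0 < σ)
    (u v : (schrodinger hW σ).domain) :
    ⟪schrodinger hW σ u, (v : L2)⟫_ℂ = ⟪(u : L2), schrodinger hW σ v⟫_ℂ := by
  have key : ∀ w : (schrodinger hW σ).domain, schrodinger hW σ w
      = (-secondDeriv w + ((σ : ℂ) ^ 2) • (w : L2)) - mulOp hW (w : L2) := fun w => by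
    rw [schrodinger_apply]; abel
  rw [key, key, inner_sub_left, inner_sub_right, inner_mulOp]
  congr 1
  conv_lhs => rw [← freeResolvent_freeOp hσ v]
  conv_rhs => rw [← freeResolvent_freeOp hσ u]
  rw [inner_freeResolvent]

/-! ### Pointwise values of the free resolvent -/

theorem continuous_neg_innerₗ : Continuous fun p : ℝ × ℝ => (-innerₗ ℝ) p.1 p.2 := by
  simp only [LinearMap.neg_apply, innerₗ_apply_apply]
  exact continuous_inner.neg

/-- On `L¹ ∩ L²`, the inverse Fourier transform of `L²(ℝ)` is given by the Fourier integral. -/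
theorem fourierInv_ae_eq {h : L2} (hint : Integrable (h : ℝ → ℂ)) :
    ((𝓕⁻ h : L2) : ℝ → ℂ) =ᵐ[volume] 𝓕⁻ (h : ℝ → ℂ) := by
  have hcont : Continuous (𝓕⁻ (h : ℝ → ℂ)) :=
    VectorFourier.fourierIntegral_continuous Real.continuous_fourierChar
      (L := -innerₗ ℝ) continuous_neg_innerₗ hint
  refine ae_eq_of_integral_contDiff_smul_eq ((Lp.memLp _).locallyIntegrable (by norm_num))
    hcont.locallyIntegrable fun g hg hgc => ?_
  have hg₁ : HasCompactSupport (Complex.ofRealCLM ∘ g) := hgc.comp_left rfl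
  have hg₂ : ContDiff ℝ ∞ (Complex.ofRealCLM ∘ g) := by fun_prop
  set φ := hg₁.toSchwartzMap hg₂ with hφ
  have hφx : ∀ x, φ x = (g x : ℂ) := fun x => rfl
  have h1 : Lp.toTemperedDistribution (𝓕⁻ h : L2) φ = Lp.toTemperedDistribution h (𝓕⁻ φ) := by
    rw [← Lp.fourierInv_toTemperedDistribution_eq, fourierInv_apply]
  rw [Lp.toTemperedDistribution_apply, Lp.toTemperedDistribution_apply] at h1
  have h2 : ∫ x, (𝓕⁻ φ) x • h x = ∫ x, φ x • 𝓕⁻ (h : ℝ → ℂ) x := by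
    rw [SchwartzMap.fourierInv_coe]
    have hflip : (-innerₗ ℝ : ℝ →ₗ[ℝ] ℝ →ₗ[ℝ] ℝ).flip = -innerₗ ℝ := by
      ext
      simp
    have := VectorFourier.integral_fourierIntegral_smul_eq_flip (L := -innerₗ ℝ)
      Real.continuous_fourierChar continuous_neg_innerₗ (φ.integrable (μ := volume)) hint
    rwa [hflip] at this
  rw [h2] at h1
  simpa only [hφx, smul_eq_mul, Complex.real_smul] using h1

/-- The resolvent symbol is square integrable. -/
theorem memLp_two_resolventSymbol {σ : ℝ} (hσ : 0 < σ) :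
    MemLp (fun ξ => (resolventSymbol σ ξ : ℂ)) 2 (volume : Measure ℝ) := by
  have hm := hasTemperateGrowth_resolventSymbol_ofReal hσ
  rw [memLp_two_iff_integrable_sq_norm hm.1.continuous.aestronglyMeasurable]
  have hc : 0 < 1 + (σ ^ 2)⁻¹ := by positivity
  refine ((integrable_inv_one_add_sq).const_mul ((σ ^ 2)⁻¹ * (1 + (σ ^ 2)⁻¹))).mono'
    (hm.1.continuous.norm.pow 2).aestronglyMeasurable (Filter.Eventually.of_forall fun ξ => ?_)
  rw [Complex.norm_real, Real.norm_eq_abs, Real.norm_eq_abs, sq_abs,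
    abs_of_nonneg (sq_nonneg _), sq, mul_assoc]
  refine mul_le_mul (resolventSymbol_le hσ ξ) ?_ (resolventSymbol_nonneg σ ξ) (by positivity)
  have hpos : 0 < σ ^ 2 + (2 * π * ξ) ^ 2 := by positivity
  have hpi : 1 ≤ (2 * π) ^ 2 := by nlinarith [Real.pi_gt_three]
  have hξ : ξ ^ 2 ≤ (2 * π * ξ) ^ 2 := by
    rw [mul_pow]; nlinarith [sq_nonneg ξ]
  rw [resolventSymbol, ← div_eq_mul_inv, inv_eq_one_div, div_le_div_iff₀ hpos (by positivity),
    one_mul, add_mul, one_mul, mul_add, inv_mul_cancel₀ (by positivity)]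
  have : 0 ≤ (σ ^ 2)⁻¹ * (2 * π * ξ) ^ 2 := by positivity
  nlinarith [sq_nonneg σ]

theorem integrable_symbolOp {σ : ℝ} (hσ : 0 < σ) (g : L2) :
    Integrable (symbolOp hσ g : ℝ → ℂ) :=
  ((memLp_two_resolventSymbol hσ).integrable_mul (Lp.memLp g)).congr
    ((mulCLM_coeFn (memLp_top_resolventSymbol hσ) g).mono fun _ hx => hx.symm)

theorem freeResolvent_ae_eq {σ : ℝ} (hσ : 0 < σ) (g : L2) :
    (freeResolvent hσ g : ℝ → ℂ) =ᵐ[volume] 𝓕⁻ (symbolOp hσ (𝓕 g) : ℝ → ℂ) :=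
  fourierInv_ae_eq (integrable_symbolOp hσ _)

/-- One-dimensional Sobolev embedding: elements of `H²(ℝ)` have continuous representatives. -/
theorem exists_continuous_rep (u : sobolevH2) :
    ∃ U : ℝ → ℂ, Continuous U ∧ ((u : L2) : ℝ → ℂ) =ᵐ[volume] U := by
  have h := freeResolvent_ae_eq one_pos (-secondDeriv u + (((1 : ℝ) : ℂ) ^ 2) • (u : L2))
  rw [freeResolvent_freeOp] at h
  exact ⟨_, VectorFourier.fourierIntegral_continuous Real.continuous_fourierChar
    (L := -innerₗ ℝ) continuous_neg_innerₗ
    (integrable_symbolOp _ _), h⟩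

/-! ### From weak to classical derivatives -/

/-- A smooth compactly supported function with integral zero has a compactly supported smooth
primitive. -/
theorem exists_primitive_of_integral_eq_zero {θ : ℝ → ℝ} (hθ : ContDiff ℝ ∞ θ)
    (hc : HasCompactSupport θ) (h0 : ∫ x, θ x = 0) :
    ∃ η : ℝ → ℝ, ContDiff ℝ ∞ η ∧ HasCompactSupport η ∧ deriv η = θ := by
  obtain ⟨R, hR⟩ := hc.isCompact.isBounded.subset_closedBall 0
  have hz : ∀ x, x ∉ Icc (-R) R → θ x = 0 := fun x hx => by
    by_contra hne
    have := hR (subset_tsupport θ hne)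
    rw [Real.closedBall_eq_Icc, zero_sub, zero_add] at this
    exact hx this
  set η : ℝ → ℝ := fun x => ∫ t in (-R)..x, θ t with hη
  have hd : ∀ x, HasDerivAt η (θ x) x := fun x =>
    intervalIntegral.integral_hasDerivAt_right (hθ.continuous.intervalIntegrable _ _)
      (hθ.continuous.stronglyMeasurableAtFilter _ _) hθ.continuous.continuousAt
  have hderiv : deriv η = θ := funext fun x => (hd x).deriv
  refine ⟨η, ?_, ?_, hderiv⟩
  · rw [contDiff_infty_iff_deriv, hderiv]
    exact ⟨fun x => (hd x).differentiableAt, hθ⟩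
  · refine HasCompactSupport.intro (isCompact_Icc (a := -R) (b := R)) fun x hx => ?_
    rw [mem_Icc, not_and_or, not_le, not_le] at hx
    rcases hx with hx | hx
    · refine (intervalIntegral.integral_congr fun t ht => ?_).trans
        (intervalIntegral.integral_zero)
      rw [uIcc_of_ge hx.le] at ht
      rcases ht.2.eq_or_lt with rfl | hlt
      -- At the endpoint `-R`, which `hz` does not cover, `θ` vanishes by continuity.
      · by_contra hne
        have hev : ∀ᶠ s in nhds (-R), θ s ≠ 0 := hθ.continuous.continuousAt.eventually_ne hne
        obtain ⟨s, hs, hs'⟩ := (hev.filter_mono nhdsWithin_le_nhds |>.and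
          (self_mem_nhdsWithin (s := Iio (-R)))).exists
        exact hs (hz s fun h => absurd h.1 (not_le.2 hs'))
      · exact hz t fun h => absurd h.1 (not_le.2 hlt)
    · rcases le_or_gt (-R) x with hRx | hRx
      · change ∫ t in (-R)..x, θ t = 0
        rw [intervalIntegral.integral_of_le hRx, ← integral_Icc_eq_integral_Ioc,
          setIntegral_eq_integral_of_forall_compl_eq_zero, h0]
        exact fun t ht => hz t fun h => ht ⟨h.1, h.2.trans hx.le⟩
      · refine (intervalIntegral.integral_congr fun t ht => ?_).trans
          (intervalIntegral.integral_zero)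
        rw [uIcc_of_ge hRx.le] at ht
        exact hz t fun h => absurd (ht.1.trans h.2) (not_le.2 hx)

/-- **du Bois-Reymond lemma**: a locally integrable function on the line whose weak derivative
vanishes is almost everywhere constant. -/
theorem exists_ae_eq_const_of_weak_deriv_eq_zero {D : ℝ → ℂ} (hD : LocallyIntegrable D)
    (h : ∀ η : ℝ → ℝ, ContDiff ℝ ∞ η → HasCompactSupport η → ∫ x, deriv η x • D x = 0) :
    ∃ K : ℂ, D =ᵐ[volume] fun _ => K := by
  let b : ContDiffBump (0 : ℝ) := ⟨1, 2, one_pos, one_lt_two⟩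
  set φ := b.normed (volume : Measure ℝ)
  have hφ : ContDiff ℝ ∞ φ := b.contDiff_normed
  have hφc : HasCompactSupport φ := b.hasCompactSupport_normed
  have hφ1 : ∫ x, φ x = 1 := b.integral_normed
  have hint : ∀ g : ℝ → ℝ, ContDiff ℝ ∞ g → HasCompactSupport g →
      Integrable fun x => g x • D x := fun g hg hgc =>
    hD.integrable_smul_left_of_hasCompactSupport hg.continuous hgc
  refine ⟨∫ x, φ x • D x, ae_eq_of_integral_contDiff_smul_eq hD
    (locallyIntegrable_const _) fun g hg hgc => ?_⟩
  have hgi : Integrable g := hg.continuous.integrable_of_hasCompactSupport hgc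
  have hφi : Integrable φ := hφ.continuous.integrable_of_hasCompactSupport hφc
  -- Subtracting a multiple of a fixed bump function turns the test function `g` into a derivative.
  set c : ℝ := ∫ x, g x
  obtain ⟨η, hη, hηc, hη'⟩ := exists_primitive_of_integral_eq_zero
    (θ := fun x => g x - c * φ x) (hg.sub (contDiff_const.mul hφ))
    (hgc.sub (hφc.mul_left (f := fun _ => c)))
    (by rw [integral_sub hgi (hφi.const_mul c), integral_const_mul, hφ1, mul_one, sub_self])
  have h0 := h η hη hηc
  have hint' : ∀ c : ℝ, Integrable fun x => c • φ x • D x := fun c => (hint φ hφ hφc).smul c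
  simp only [hη', sub_smul, mul_smul] at h0
  rw [integral_sub (hint g hg hgc) (hint' c), integral_smul, sub_eq_zero] at h0
  rw [h0, integral_smul_const]

/-- If the distributional derivative of `f` is represented by a continuous function `g`, then `f`
is represented by a classical primitive of `g`. -/
theorem exists_hasDerivAt_of_lineDerivOp_eq {f G : L2} {g : ℝ → ℂ} (hg : Continuous g)
    (hG : (G : ℝ → ℂ) =ᵐ[volume] g) (h : ∂_{(1 : ℝ)} (toDistr f) = toDistr G) :
    ∃ F : ℝ → ℂ, (∀ x, HasDerivAt F (g x) x) ∧ (f : ℝ → ℂ) =ᵐ[volume] F := by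
  set F₀ : ℝ → ℂ := fun x => ∫ t in (0 : ℝ)..x, g t with hF₀
  have hd : ∀ x, HasDerivAt F₀ (g x) x := fun x =>
    intervalIntegral.integral_hasDerivAt_right (hg.intervalIntegrable _ _)
      (hg.stronglyMeasurableAtFilter _ _) hg.continuousAt
  have hF₀c : Continuous F₀ := continuous_iff_continuousAt.2 fun x => (hd x).continuousAt
  have hfl : LocallyIntegrable (f : ℝ → ℂ) := (Lp.memLp f).locallyIntegrable (by norm_num)
  obtain ⟨K, hK⟩ := exists_ae_eq_const_of_weak_deriv_eq_zero
    (D := fun x => f x - F₀ x) (hfl.sub hF₀c.locallyIntegrable) fun η hη hηc => by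
      have hηd : ∀ x, HasDerivAt (fun x => (η x : ℂ)) ((deriv η x : ℝ) : ℂ) x := fun x =>
        ((hη.differentiable (by simp)) x).hasDerivAt.ofReal_comp
      have hg₁ : HasCompactSupport (Complex.ofRealCLM ∘ η) := hηc.comp_left rfl
      have hg₂ : ContDiff ℝ ∞ (Complex.ofRealCLM ∘ η) := by fun_prop
      have hη' : Continuous (deriv η) := hη.continuous_deriv (by simp)
      set φ := hg₁.toSchwartzMap hg₂ with hφ
      have hφx : ∀ x, φ x = (η x : ℂ) := fun x => rfl
      have hφ' : ∀ x, (∂_{(1 : ℝ)} φ) x = ((deriv η x : ℝ) : ℂ) := fun x => by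
        rw [SchwartzMap.lineDerivOp_apply_eq_fderiv]
        exact (hηd x).hasFDerivAt.fderiv ▸ by simp
      have h1 : (∂_{(1 : ℝ)} (toDistr f)) φ = (toDistr G) φ := by rw [h]
      rw [lineDerivOp_apply_apply, map_neg] at h1
      change -(Lp.toTemperedDistribution f (∂_{(1 : ℝ)} φ)) = Lp.toTemperedDistribution G φ at h1
      rw [Lp.toTemperedDistribution_apply, Lp.toTemperedDistribution_apply] at h1
      have hGg : ∫ x, φ x • G x = ∫ x, (η x : ℂ) * g x :=
        integral_congr_ae (hG.mono fun x hx => by simp only [hx, hφx, smul_eq_mul])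
      have hparts : ∫ x, (η x : ℂ) * g x = -∫ x, ((deriv η x : ℝ) : ℂ) * F₀ x := by
        refine integral_mul_deriv_eq_deriv_mul_of_integrable (fun x _ => hηd x)
          (fun x _ => hd x) ?_ ?_ ?_
        · exact ((Complex.continuous_ofReal.comp hη.continuous).mul
            hg).integrable_of_hasCompactSupport (hg₁.mul_right)
        · exact ((Complex.continuous_ofReal.comp hη').mul
            hF₀c).integrable_of_hasCompactSupport ((hηc.deriv.comp_left (g := Complex.ofReal)
              Complex.ofReal_zero).mul_right)
        · exact ((Complex.continuous_ofReal.comp hη.continuous).mul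
            hF₀c).integrable_of_hasCompactSupport (hg₁.mul_right)
      simp only [smul_sub]
      rw [integral_sub (hfl.integrable_smul_left_of_hasCompactSupport hη' hηc.deriv)
        (hF₀c.locallyIntegrable.integrable_smul_left_of_hasCompactSupport hη' hηc.deriv)]
      rw [hGg, hparts, neg_inj] at h1
      simp only [hφ', smul_eq_mul] at h1
      simp only [Complex.real_smul]
      rw [h1, sub_self]
  refine ⟨fun x => F₀ x + K, fun x => (hd x).add_const K, hK.mono fun x hx => ?_⟩
  change _ = F₀ x + K
  rw [← show f x - F₀ x = K from hx, add_sub_cancel]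

/-! ### Square-integrable solutions of the Schrödinger equation -/

/-- `U` is a classical solution of `U'' = q U` with derivative `V`, and both `U` and `V` are square
integrable on the line. -/
structure IsL2Solution (q : ℝ → ℝ) (U V : ℝ → ℂ) : Prop where
  deriv_fst : ∀ x, HasDerivAt U (V x) x
  deriv_snd : ∀ x, HasDerivAt V ((q x : ℂ) * U x) x
  memLp_fst : MemLp U 2 (volume : Measure ℝ)
  memLp_snd : MemLp V 2 (volume : Measure ℝ)

namespace IsL2Solution

variable {q : ℝ → ℝ} {U V U' V' : ℝ → ℂ}

theorem conj (h : IsL2Solution q U V) :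
    IsL2Solution q (fun x => star (U x)) (fun x => star (V x)) where
  deriv_fst x := (h.deriv_fst x).star
  deriv_snd x := by
    have := (h.deriv_snd x).star
    simpa using this
  memLp_fst := h.memLp_fst.star
  memLp_snd := h.memLp_snd.star

/-- The Wronskian is constant and integrable, hence zero. -/
theorem wronskian_eq_zero (h : IsL2Solution q U V) (h' : IsL2Solution q U' V') (x : ℝ) :
    U x * V' x - U' x * V x = 0 := by
  have hd : ∀ x, HasDerivAt (fun x => U x * V' x - U' x * V x) 0 x := fun x => by
    convert! ((h.deriv_fst x).mul (h'.deriv_snd x)).sub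
      ((h'.deriv_fst x).mul (h.deriv_snd x)) using 1
    ring
  have hconst := is_const_of_deriv_eq_zero (fun x => (hd x).differentiableAt)
    (fun x => (hd x).deriv)
  have hint : Integrable fun x => U x * V' x - U' x * V x :=
    (h.memLp_fst.integrable_mul h'.memLp_snd).sub (h'.memLp_fst.integrable_mul h.memLp_snd)
  have hint' : Integrable (fun _ : ℝ => U x * V' x - U' x * V x) := by
    refine hint.congr (Filter.Eventually.of_forall fun y => hconst y x)
  rw [integrable_const_iff] at hint'
  rcases hint' with h0 | h0
  · exact h0
  · exact absurd h0 (by simp [isFiniteMeasure_iff])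

/-- Two solutions with proportional initial data are proportional. -/
theorem eq_const_mul_of_initial (hq : ∃ B : ℝ, ∀ x, |q x| ≤ B) (h : IsL2Solution q U V)
    (h' : IsL2Solution q U' V') {c : ℂ} (h0 : U' 0 = c * U 0) (h1 : V' 0 = c * V 0) :
    ∀ x, U' x = c * U x := by
  obtain ⟨B, hB⟩ := hq
  let v : ℝ → ℂ × ℂ → ℂ × ℂ := fun t p => (p.2, (q t : ℂ) * p.1)
  have hv : ∀ t, LipschitzOnWith (max 1 B.toNNReal) (v t) univ := fun t => by
    rw [lipschitzOnWith_univ]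
    refine LipschitzWith.prodMk (f := fun p : ℂ × ℂ => p.2) (Kf := 1)
      (g := fun p : ℂ × ℂ => (q t : ℂ) * p.1) (Kg := B.toNNReal) LipschitzWith.prod_snd ?_
    refine LipschitzWith.of_dist_le_mul fun p p' => ?_
    rw [dist_eq_norm, ← mul_sub, norm_mul, Complex.norm_real, Real.norm_eq_abs, ← dist_eq_norm]
    exact mul_le_mul ((hB t).trans (Real.le_coe_toNNReal B)) (le_max_left _ _) dist_nonneg
      NNReal.zero_le_coe
  have key := ODE_solution_unique_univ (t₀ := 0) (v := v) (s := fun _ => univ) hv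
    (f := fun t => (U' t, V' t)) (g := fun t => (c * U t, c * V t))
    (fun t => ⟨(h'.deriv_fst t).prodMk (h'.deriv_snd t), mem_univ _⟩)
    (fun t => ⟨by
      convert! ((h.deriv_fst t).const_mul c).prodMk ((h.deriv_snd t).const_mul c) using 1
      simp only [v]
      rw [mul_left_comm], mem_univ _⟩) (by rw [h0, h1])
  exact fun x => congrArg Prod.fst (congrFun key x)

/-- The space of square-integrable solutions is at most one-dimensional. -/
theorem exists_eq_const_mul (hq : ∃ B : ℝ, ∀ x, |q x| ≤ B) (h : IsL2Solution q U V)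
    (hne : ∃ x, U x ≠ 0) (h' : IsL2Solution q U' V') : ∃ c : ℂ, ∀ x, U' x = c * U x := by
  have hw := h.wronskian_eq_zero h' 0
  by_cases hU : U 0 = 0
  · by_cases hV : V 0 = 0
    · obtain ⟨x, hx⟩ := hne
      refine absurd ?_ hx
      simpa using eq_const_mul_of_initial hq h h (c := 0) (by simp [hU]) (by simp [hV]) x
    · refine ⟨V' 0 / V 0, eq_const_mul_of_initial hq h h' ?_ (by field_simp)⟩
      rw [hU, zero_mul, zero_sub, neg_eq_zero] at hw
      rw [(mul_eq_zero.1 hw).resolve_right hV, hU, mul_zero]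
  · refine ⟨U' 0 / U 0, eq_const_mul_of_initial hq h h' (by field_simp) ?_⟩
    field_simp
    linear_combination hw

end IsL2Solution

theorem exists_bound_potential {W : ℝ → ℝ} (hW : ExpLocalized W) (σ : ℝ) :
    ∃ B : ℝ, ∀ x, |σ ^ 2 - W x| ≤ B := by
  obtain ⟨C, α, hα, h⟩ := hW.decay
  have hC : 0 ≤ C := by simpa using (abs_nonneg _).trans (h 0)
  refine ⟨σ ^ 2 + C, fun x => (abs_sub _ _).trans ?_⟩
  rw [abs_of_nonneg (sq_nonneg σ)]
  refine add_le_add_right ((h x).trans (mul_le_of_le_one_right hC ?_)) _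
  rw [Real.exp_le_one_iff]
  nlinarith [abs_nonneg x]

/-- Elements of the kernel of the Schrödinger operator are represented by classical solutions of
`U'' = (σ² - W) U`. -/
theorem exists_isL2Solution {W : ℝ → ℝ} (hW : ExpLocalized W) {σ : ℝ}
    (u : (schrodinger hW σ).domain) (hu : schrodinger hW σ u = 0) :
    ∃ U V : ℝ → ℂ, IsL2Solution (fun x => σ ^ 2 - W x) U V ∧
      ((u : L2) : ℝ → ℂ) =ᵐ[volume] U := by
  obtain ⟨U₀, hU₀, hu₀⟩ := exists_continuous_rep u
  have hmem : MemSobolev 2 2 (toDistr (u : L2)) := u.2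
  obtain ⟨v, hv⟩ := memSobolev_zero_iff.1
    ((hmem.lineDerivOp (m := (1 : ℝ))).mono (s' := 0) (by norm_num))
  have hv' : ∂_{(1 : ℝ)} (toDistr (u : L2)) = toDistr v := hv
  have hv'' : ∂_{(1 : ℝ)} (toDistr v) = toDistr (secondDeriv u) := by
    rw [← hv']
    exact (toDistr_secondDeriv u).symm
  have hq : (secondDeriv u : ℝ → ℂ)
      =ᵐ[volume] fun x => ((σ ^ 2 - W x : ℝ) : ℂ) * U₀ x := by
    have heq : secondDeriv u = ((σ : ℂ) ^ 2) • (u : L2) - mulOp hW (u : L2) := by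
      rw [schrodinger_apply] at hu
      linear_combination (norm := abel) -hu
    rw [heq]
    filter_upwards [Lp.coeFn_sub (((σ : ℂ) ^ 2) • (u : L2)) (mulOp hW (u : L2)),
      Lp.coeFn_smul ((σ : ℂ) ^ 2) (u : L2), mulOp_coeFn hW (u : L2), hu₀] with x h1 h2 h3 h4
    rw [h1, Pi.sub_apply, h2, h3, Pi.smul_apply, h4, smul_eq_mul]
    push_cast
    ring
  have hqc : Continuous fun x => ((σ ^ 2 - W x : ℝ) : ℂ) * U₀ x :=
    (Complex.continuous_ofReal.comp (continuous_const.sub hW.smooth.continuous)).mul hU₀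
  -- `u''` has the continuous representative `(σ² - W) U₀`, so `u'` is represented by a `C¹`
  -- function, and then `u` by a `C²` function.
  obtain ⟨V, hV, hvV⟩ := exists_hasDerivAt_of_lineDerivOp_eq hqc hq hv''
  have hVc : Continuous V := continuous_iff_continuousAt.2 fun x => (hV x).continuousAt
  obtain ⟨U, hU, huU⟩ := exists_hasDerivAt_of_lineDerivOp_eq hVc hvV hv'
  have hUc : Continuous U := continuous_iff_continuousAt.2 fun x => (hU x).continuousAt
  have hUU : U₀ = U := (hU₀.ae_eq_iff_eq volume hUc).1 (hu₀.symm.trans huU)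
  subst hUU
  exact ⟨U₀, V, ⟨hU, hV, (memLp_congr_ae huU).1 (Lp.memLp _),
    (memLp_congr_ae hvV).1 (Lp.memLp _)⟩, huU⟩

theorem exists_ne_zero_of_ae_eq {u : L2} (hu : u ≠ 0) {U : ℝ → ℂ}
    (h : (u : ℝ → ℂ) =ᵐ[volume] U) : ∃ x, U x ≠ 0 := by
  by_contra! h0
  exact hu ((Lp.eq_zero_iff_ae_eq_zero).2 (h.mono fun x hx => by rw [hx, h0 x]; rfl))

/-- The kernel of the Schrödinger operator is at most one-dimensional. -/
theorem exists_eq_smul_of_ker {W : ℝ → ℝ} (hW : ExpLocalized W) {σ : ℝ}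
    {ψ u : (schrodinger hW σ).domain} (hψ : schrodinger hW σ ψ = 0) (hψ0 : (ψ : L2) ≠ 0)
    (hu : schrodinger hW σ u = 0) : ∃ c : ℂ, (u : L2) = c • (ψ : L2) := by
  obtain ⟨Ψ, Ψ', hΨ, hψΨ⟩ := exists_isL2Solution hW ψ hψ
  obtain ⟨U, U', hU, huU⟩ := exists_isL2Solution hW u hu
  obtain ⟨c, hc⟩ := hΨ.exists_eq_const_mul (exists_bound_potential hW σ)
    (exists_ne_zero_of_ae_eq hψ0 hψΨ) hU
  refine ⟨c, Lp.ext ?_⟩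
  filter_upwards [hψΨ, huU, Lp.coeFn_smul c (ψ : L2)] with x h1 h2 h3
  rw [h2, h3, Pi.smul_apply, h1, hc, smul_eq_mul]

/-- Since the potential is real, an eigenfunction in the kernel is real up to a phase; so the
bilinear pairing `∫ γ ψ²` vanishes exactly when the inner product `⟪ψ, γ ψ⟫` does. -/
theorem integral_eq_zero_iff_inner_eq_zero {W γ : ℝ → ℝ} (hW : ExpLocalized W)
    (hγ : ExpLocalized γ) {σ : ℝ} {ψ : (schrodinger hW σ).domain}
    (hψ : schrodinger hW σ ψ = 0) (hψ0 : (ψ : L2) ≠ 0) :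
    (∫ x : ℝ, (γ x : ℂ) * (ψ : L2) x * (ψ : L2) x) = 0
      ↔ ⟪(ψ : L2), mulOp hγ (ψ : L2)⟫_ℂ = 0 := by
  obtain ⟨Ψ, Ψ', hΨ, hψΨ⟩ := exists_isL2Solution hW ψ hψ
  have hne := exists_ne_zero_of_ae_eq hψ0 hψΨ
  obtain ⟨c, hc⟩ := hΨ.exists_eq_const_mul (exists_bound_potential hW σ) hne hΨ.conj
  have hc0 : c ≠ 0 := by
    rintro rfl
    obtain ⟨x, hx⟩ := hne
    exact hx (by simpa using hc x)
  have : ⟪(ψ : L2), mulOp hγ (ψ : L2)⟫_ℂ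
      = c * ∫ x : ℝ, (γ x : ℂ) * (ψ : L2) x * (ψ : L2) x := by
    rw [L2.inner_def, ← integral_const_mul]
    refine integral_congr_ae ?_
    filter_upwards [mulOp_coeFn hγ (ψ : L2), hψΨ] with x h1 h2
    have h3 : (starRingEnd ℂ) (Ψ x) = c * Ψ x := hc x
    rw [h1, RCLike.inner_apply, h2, h3]
    ring
  rw [this, mul_eq_zero, or_iff_right hc0]

/-! ### Compactness -/

/-- Bounded sequences in a separable Hilbert space have weakly convergent subsequences. -/
theorem exists_weakly_tendsto_subseq {H : Type*} [NormedAddCommGroup H] [InnerProductSpace ℂ H]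
    [CompleteSpace H] [TopologicalSpace.SeparableSpace H] (g : ℕ → H) {r : ℝ}
    (hg : ∀ n, ‖g n‖ ≤ r) :
    ∃ (g' : H) (φ : ℕ → ℕ), ‖g'‖ ≤ r ∧ StrictMono φ ∧
      ∀ h : H, Filter.Tendsto (fun n => ⟪h, g (φ n)⟫_ℂ) Filter.atTop (nhds ⟪h, g'⟫_ℂ) := by
  obtain ⟨ℓ, hℓ, φ, hφ, hlim⟩ := WeakDual.isSeqCompact_closedBall ℂ H (0 : StrongDual ℂ H) r
    (x := fun n => StrongDual.toWeakDual (InnerProductSpace.toDual ℂ H (g n)))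
    (fun n => by simpa using! hg n)
  refine ⟨(InnerProductSpace.toDual ℂ H).symm (WeakDual.toStrongDual ℓ), φ, ?_, hφ, fun h => ?_⟩
  · rw [LinearIsometryEquiv.norm_map]
    simpa using hℓ
  · have h1 : Filter.Tendsto (fun n => ⟪g (φ n), h⟫_ℂ) Filter.atTop (nhds (ℓ h)) :=
      ((WeakDual.eval_continuous h).tendsto ℓ).comp hlim
    have h2 := (Complex.continuous_conj.tendsto _).comp h1
    have h3 : ℓ h = ⟪(InnerProductSpace.toDual ℂ H).symm (WeakDual.toStrongDual ℓ), h⟫_ℂ := by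
      rw [InnerProductSpace.toDual_symm_apply]; rfl
    rw [h3] at h2
    simpa only [Function.comp_def, inner_conj_symm] using h2

/-- An operator of the form `(K g)(x) = w(x) ⟪G x, g⟫` with `w` square integrable and `G` bounded
is compact (it is a Hilbert–Schmidt operator). -/
theorem isCompactOperator_of_kernel (K : L2 →L[ℂ] L2) {w : ℝ → ℂ}
    (hw : MemLp w 2 (volume : Measure ℝ)) {G : ℝ → L2} {N : ℝ} (hG : ∀ x, ‖G x‖ ≤ N)
    (hK : ∀ g : L2, (K g : ℝ → ℂ) =ᵐ[volume] fun x => w x * ⟪G x, g⟫_ℂ) :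
    IsCompactOperator K := by
  have hN : 0 ≤ N := (norm_nonneg _).trans (hG 0)
  have : Fact ((2 : ℝ≥0∞) ≠ ⊤) := ⟨by norm_num⟩
  have : SecondCountableTopology L2 := Lp.SecondCountableTopology
  refine (isCompactOperator_iff_image_closedBall_subset_compact (K : L2 →ₗ[ℂ] L2) one_pos).2
    ⟨_, IsSeqCompact.isCompact ?_, Subset.rfl⟩
  intro y hy
  choose g hg hgy using hy
  simp only [mem_closedBall_zero_iff] at hg
  -- Weak convergence gives pointwise convergence of the images, which are dominated by
  -- `2 N ‖w‖ ∈ L²`, so the convergence is in norm.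
  obtain ⟨g', φ, hg', hφ, hlim⟩ := exists_weakly_tendsto_subseq g hg
  refine ⟨K g', ⟨g', by simpa using hg', rfl⟩, φ, hφ, ?_⟩
  have hsq : Filter.Tendsto (fun n => ⟪K (g (φ n) - g'), K (g (φ n) - g')⟫_ℂ) Filter.atTop
      (nhds (∫ _ : ℝ, (0 : ℂ))) := by
    simp only [L2.inner_def]
    refine tendsto_integral_of_dominated_convergence (fun x => ‖w x‖ ^ 2 * (N * 2) ^ 2)
      (fun n => ?_) (((memLp_two_iff_integrable_sq_norm hw.1).1 hw).mul_const _)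
      (fun n => ?_) ?_
    · exact (Lp.aestronglyMeasurable _).inner (Lp.aestronglyMeasurable _)
    · filter_upwards [hK (g (φ n) - g')] with x hx
      have hb : ‖K (g (φ n) - g') x‖ ≤ ‖w x‖ * (N * 2) := by
        rw [hx, norm_mul]
        refine mul_le_mul_of_nonneg_left ((norm_inner_le_norm _ _).trans ?_) (norm_nonneg _)
        refine mul_le_mul (hG x) ((norm_sub_le _ _).trans ?_) (norm_nonneg _) hN
        linarith [hg (φ n)]
      refine (norm_inner_le_norm _ _).trans ?_
      rw [← mul_pow, sq]
      exact mul_le_mul hb hb (norm_nonneg _) (by positivity)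
    · have hall : ∀ᵐ x : ℝ, ∀ n, K (g (φ n) - g') x = w x * ⟪G x, g (φ n) - g'⟫_ℂ :=
        ae_all_iff.2 fun n => hK _
      filter_upwards [hall] with x hx
      have h1 : Filter.Tendsto (fun n => K (g (φ n) - g') x) Filter.atTop (nhds 0) := by
        simp only [hx, inner_sub_right]
        have := ((hlim (G x)).sub_const ⟪G x, g'⟫_ℂ).const_mul (w x)
        simpa using this
      simpa using h1.inner (𝕜 := ℂ) h1
  rw [integral_zero] at hsq
  have hn := hsq.norm
  simp only [inner_self_eq_norm_sq_to_K, norm_zero, norm_pow, RCLike.norm_ofReal,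
    abs_norm] at hn
  have h2 := hn.sqrt
  simp only [Real.sqrt_sq (norm_nonneg _), Real.sqrt_zero, map_sub] at h2
  rw [tendsto_iff_norm_sub_tendsto_zero]
  refine h2.congr fun n => ?_
  rw [Function.comp_apply, ← hgy]
  rfl

theorem ExpLocalized.memLp_two {W : ℝ → ℝ} (hW : ExpLocalized W) :
    MemLp (fun x => (W x : ℂ)) 2 (volume : Measure ℝ) := by
  have hc : Continuous fun x => (W x : ℂ) :=
    Complex.continuous_ofReal.comp hW.smooth.continuous
  obtain ⟨C, α, hα, h⟩ := hW.decay
  rw [memLp_two_iff_integrable_sq_norm hc.aestronglyMeasurable]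
  refine (integrable_inv_one_add_sq.const_mul (C ^ 2 * (1 + (α ^ 2)⁻¹))).mono'
    (hc.norm.pow 2).aestronglyMeasurable (Filter.Eventually.of_forall fun x => ?_)
  rw [Complex.norm_real, Real.norm_eq_abs, Real.norm_eq_abs, sq_abs, abs_of_nonneg (sq_nonneg _)]
  have h1 : W x ^ 2 ≤ C ^ 2 * Real.exp (-α * |x|) ^ 2 := by
    rw [← sq_abs, ← mul_pow]
    exact pow_le_pow_left₀ (abs_nonneg _) (h x) 2
  refine h1.trans ?_
  rw [mul_assoc]
  refine mul_le_mul_of_nonneg_left ?_ (sq_nonneg C)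
  rw [← Real.exp_nat_mul]
  have h2 : 1 + (α * x) ^ 2 ≤ Real.exp (2 * (α * |x|)) := by
    have h3 := Real.quadratic_le_exp_of_nonneg (x := 2 * (α * |x|)) (by positivity)
    have h4 : (α * |x|) ^ 2 = (α * x) ^ 2 := by rw [mul_pow, mul_pow, sq_abs]
    have h5 : 0 ≤ α * |x| := by positivity
    nlinarith [sq_nonneg (α * x)]
  have h6 : ((2 : ℕ) : ℝ) * (-α * |x|) = -(2 * (α * |x|)) := by push_cast; ring
  rw [h6, Real.exp_neg, ← div_eq_mul_inv, inv_eq_one_div, div_le_div_iff₀ (Real.exp_pos _)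
    (by positivity), one_mul]
  refine le_trans ?_ (mul_le_mul_of_nonneg_left h2 (by positivity))
  have h7 : (1 + (α ^ 2)⁻¹) * (1 + (α * x) ^ 2)
      = 1 + x ^ 2 + (α ^ 2)⁻¹ + (α * x) ^ 2 := by
    field_simp
    ring
  rw [h7]
  nlinarith [sq_nonneg (α * x), inv_nonneg.2 (sq_nonneg α)]

theorem memLp_evalKernel {σ : ℝ} (hσ : 0 < σ) (x : ℝ) :
    MemLp (fun ξ => star ((𝐞 (ξ * x) : ℂ)) * (resolventSymbol σ ξ : ℂ)) 2
      (volume : Measure ℝ) := by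
  refine (memLp_two_resolventSymbol hσ).of_le (Continuous.aestronglyMeasurable ?_)
    (Filter.Eventually.of_forall fun ξ => ?_)
  · have := Real.continuous_fourierChar
    exact (continuous_star.comp (continuous_subtype_val.comp
      (this.comp (continuous_mul_const x)))).mul
      (hasTemperateGrowth_resolventSymbol_ofReal hσ).1.continuous
  · rw [norm_mul, norm_star, Circle.norm_coe, one_mul]

/-- The free resolvent evaluates pointwise as the inner product with an `L²` function. -/
theorem freeResolvent_ae_eq_inner {σ : ℝ} (hσ : 0 < σ) (g : L2) :
    (freeResolvent hσ g : ℝ → ℂ) =ᵐ[volume]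
      fun x => ⟪(𝓕⁻ ((memLp_evalKernel hσ x).toLp _ : L2) : L2), g⟫_ℂ := by
  filter_upwards [freeResolvent_ae_eq hσ g] with x hx
  rw [hx, Real.fourierInv_eq, ← Lp.inner_fourier_eq, fourier_fourierInv_eq, L2.inner_def]
  refine integral_congr_ae ?_
  filter_upwards [mulCLM_coeFn (memLp_top_resolventSymbol hσ) (𝓕 g),
    (memLp_evalKernel hσ x).coeFn_toLp] with ξ h1 h2
  change (symbolOp hσ (𝓕 g)) ξ = _ at h1
  rw [h1, h2, Circle.smul_def]
  simp [mul_comm x ξ]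
  ring

theorem norm_fourierInv_evalKernel {σ : ℝ} (hσ : 0 < σ) (x : ℝ) :
    ‖(𝓕⁻ ((memLp_evalKernel hσ x).toLp _ : L2) : L2)‖
      ≤ ‖((memLp_two_resolventSymbol hσ).toLp _ : L2)‖ := by
  rw [← Lp.norm_fourier_eq, fourier_fourierInv_eq]
  refine Lp.norm_le_norm_of_ae_le ?_
  filter_upwards [(memLp_evalKernel hσ x).coeFn_toLp,
    (memLp_two_resolventSymbol hσ).coeFn_toLp] with ξ h1 h2
  rw [h1, h2, norm_mul, norm_star, Circle.norm_coe, one_mul]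

/-- The potential is relatively compact with respect to the free operator. -/
theorem isCompactOperator_mulCLM_freeResolvent {W : ℝ → ℝ} (hW : ExpLocalized W) {σ : ℝ}
    (hσ : 0 < σ) :
    IsCompactOperator ((mulCLM (hW.memLp_top.toLp _)).comp (freeResolvent hσ)) := by
  refine isCompactOperator_of_kernel _ hW.memLp_two (norm_fourierInv_evalKernel hσ) fun g => ?_
  filter_upwards [mulCLM_coeFn hW.memLp_top (freeResolvent hσ g),
    freeResolvent_ae_eq_inner hσ g] with x h1 h2
  rw [ContinuousLinearMap.comp_apply, h1, h2]

/-- The rank-one operator `u ↦ ⟪ψ, u⟫ ψ`. -/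
def rankOneSelf (ψ : L2) : L2 →L[ℂ] L2 := (innerSL ℂ ψ).smulRight ψ

theorem rankOneSelf_apply (ψ u : L2) : rankOneSelf ψ u = ⟪ψ, u⟫_ℂ • ψ := rfl

theorem isCompactOperator_rankOneSelf_freeResolvent (ψ : L2) {σ : ℝ} (hσ : 0 < σ) :
    IsCompactOperator ((rankOneSelf ψ).comp (freeResolvent hσ)) := by
  refine isCompactOperator_of_kernel _ (Lp.memLp ψ)
    (G := fun _ => freeResolvent hσ ψ) (fun _ => le_rfl) fun g => ?_
  have h : (rankOneSelf ψ).comp (freeResolvent hσ) g = ⟪freeResolvent hσ ψ, g⟫_ℂ • ψ := by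
    rw [inner_freeResolvent]; rfl
  rw [h]
  filter_upwards [Lp.coeFn_smul ⟪freeResolvent hσ ψ, g⟫_ℂ ψ] with x hx
  rw [hx, Pi.smul_apply, smul_eq_mul, mul_comm]

/-! ### Solvability of the inhomogeneous equation -/

theorem schrodinger_freeResolvent {W : ℝ → ℝ} (hW : ExpLocalized W) {σ : ℝ} (hσ : 0 < σ)
    (g : L2) : schrodinger hW σ ⟨freeResolvent hσ g, freeResolvent_mem hσ g⟩
      = g - mulOp hW (freeResolvent hσ g) := by
  have h := freeOp_freeResolvent hσ g
  change -secondDeriv ⟨freeResolvent hσ g, freeResolvent_mem hσ g⟩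
    - mulOp hW (freeResolvent hσ g) + ((σ : ℂ) ^ 2) • freeResolvent hσ g = _
  linear_combination (norm := abel) h

/-- **Fredholm alternative** for the Schrödinger operator: if its kernel is spanned by `ψ`, then
every `f` orthogonal to `ψ` lies in its range. Adding the projection onto `ψ` makes the operator
injective, hence surjective, and on `ψ`-orthogonal data the added term does not contribute. -/
theorem exists_schrodinger_eq {W : ℝ → ℝ} (hW : ExpLocalized W) {σ : ℝ} (hσ : 0 < σ)
    {ψ : (schrodinger hW σ).domain} (hψ : schrodinger hW σ ψ = 0) (hψ0 : (ψ : L2) ≠ 0)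
    {f : L2} (hf : ⟪(ψ : L2), f⟫_ℂ = 0) :
    ∃ v : (schrodinger hW σ).domain, schrodinger hW σ v = f := by
  have hψψ : ⟪(ψ : L2), (ψ : L2)⟫_ℂ ≠ 0 := inner_self_ne_zero.2 hψ0
  -- Pairing with `ψ` annihilates the range, so the rank-one term is determined by the data.
  have hzero : ∀ (v : (schrodinger hW σ).domain) (f : L2), ⟪(ψ : L2), f⟫_ℂ = 0 →
      schrodinger hW σ v + rankOneSelf (ψ : L2) v = f → ⟪(ψ : L2), (v : L2)⟫_ℂ = 0 := by
    intro v f hf h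
    have h1 := congrArg (fun y => ⟪(ψ : L2), y⟫_ℂ) h
    simp only [inner_add_right, rankOneSelf_apply, inner_smul_right] at h1
    rw [← inner_schrodinger hW hσ, hψ, inner_zero_left, zero_add, hf, mul_eq_zero] at h1
    exact h1.resolve_right hψψ
  set K : L2 →L[ℂ] L2 := (mulCLM (hW.memLp_top.toLp _)).comp (freeResolvent hσ)
    - (rankOneSelf (ψ : L2)).comp (freeResolvent hσ)
  have hK : IsCompactOperator K := (isCompactOperator_mulCLM_freeResolvent hW hσ).sub
    (isCompactOperator_rankOneSelf_freeResolvent _ hσ)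
  have hKg : ∀ g, g - K g
      = schrodinger hW σ ⟨freeResolvent hσ g, freeResolvent_mem hσ g⟩
        + rankOneSelf (ψ : L2) (freeResolvent hσ g) := fun g => by
    rw [schrodinger_freeResolvent]
    change g - (mulOp hW (freeResolvent hσ g) - rankOneSelf (ψ : L2) (freeResolvent hσ g)) = _
    abel
  rcases hK.hasEigenvalue_or_mem_resolventSet one_ne_zero with h | h
  · obtain ⟨g, hg⟩ := h.exists_hasEigenvector
    exfalso
    have h1 : K g = g := by simpa using hg.apply_eq_smul
    have h2 := hKg g
    rw [h1, sub_self] at h2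
    have h3 := hzero _ 0 (inner_zero_right _) h2.symm
    rw [rankOneSelf_apply, h3, zero_smul, add_zero] at h2
    -- `(-∂ₓ² + σ²)⁻¹ g` lies in the kernel `ℂ ψ` and is orthogonal to `ψ`, so it vanishes.
    obtain ⟨c, hc⟩ := exists_eq_smul_of_ker hW hψ hψ0 h2.symm
    rw [hc, inner_smul_right, mul_eq_zero] at h3
    rw [h3.resolve_right hψψ, zero_smul] at hc
    refine hg.2 ?_
    have h5 : (⟨freeResolvent hσ g, freeResolvent_mem hσ g⟩ : sobolevH2) = 0 := Subtype.ext hc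
    have h6 := freeOp_freeResolvent hσ g
    rw [h5, map_zero, show freeResolvent hσ g = 0 from hc, smul_zero, neg_zero, add_zero] at h6
    exact h6.symm
  · rw [spectrum.mem_resolventSet_iff, ContinuousLinearMap.isUnit_iff_bijective] at h
    obtain ⟨g, hg⟩ := h.2 f
    have hg' : g - K g = f := by simpa using hg
    rw [hKg] at hg'
    have h3 := hzero _ f hf hg'
    rw [rankOneSelf_apply, h3, zero_smul, add_zero] at hg'
    exact ⟨_, hg'⟩

/-! ### Algebraic multiplicity and Jordan chains -/

/-- If the linearly independent vectors `b` are generalized eigenvectors and their span contains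
every preimage under `T - μ` of its elements, then `b` spans the generalized eigenspace. -/
theorem algMultiplicity_eq_of_linearIndependent {E : Type*} [AddCommGroup E] [Module ℂ E]
    (T : E →ₗ.[ℂ] E) (μ : ℂ) {n : ℕ} {b : Fin n → E} (hb : LinearIndependent ℂ b)
    (hmem : ∀ i, ∃ k, b i ∈ genKer T μ k)
    (hspan : ∀ x : T.domain, T x - μ • (x : E) ∈ Submodule.span ℂ (range b) →
      (x : E) ∈ Submodule.span ℂ (range b)) :
    algMultiplicity T μ = n := by
  have hS : (⨆ k : ℕ, genKer T μ k : Submodule ℂ E) = Submodule.span ℂ (range b) := by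
    apply le_antisymm
    · refine iSup_le fun k => ?_
      induction k with
      | zero => exact bot_le
      | succ k ih =>
        intro x hx
        obtain ⟨h, hx'⟩ := (mem_genKer_succ T μ k x).1 hx
        exact hspan ⟨x, h⟩ (ih hx')
    · rw [Submodule.span_le]
      rintro _ ⟨i, rfl⟩
      obtain ⟨k, hk⟩ := hmem i
      exact Submodule.mem_iSup_of_mem k hk
  have : Module.Finite ℂ (Submodule.span ℂ (range b)) :=
    FiniteDimensional.span_of_finite ℂ (finite_range b)
  rw [algMultiplicity, hS, ← Module.finrank_eq_rank, finrank_span_eq_card hb, Fintype.card_fin,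
    map_natCast]

section Linearization

variable {W γ : ℝ → ℝ} {hW : ExpLocalized W} {hγ : ExpLocalized γ} {σ ε : ℝ}

theorem linearization_eq_iff (v : (schrodinger hW σ).domain) (w a b : L2) :
    linearization hW hγ σ ε ⟨((v : L2), w), ⟨v.2, trivial⟩⟩ = (a, b)
      ↔ w = a ∧ schrodinger hW σ v = -b - (ε : ℂ) • mulOp hγ w := by
  change (w, -(schrodinger hW σ v) - (ε : ℂ) • mulOp hγ w) = (a, b) ↔ _
  rw [Prod.mk_inj]
  refine and_congr_right fun _ => ⟨fun h => ?_, fun h => ?_⟩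
  · rw [← h]; abel
  · rw [h]; abel

variable {ψ : (schrodinger hW σ).domain}

theorem mem_genKer_one (hψ : schrodinger hW σ ψ = 0) :
    ((ψ : L2), (0 : L2)) ∈ genKer (linearization hW hγ σ ε) 0 1 := by
  refine (mem_genKer_succ _ _ _ _).2 ⟨⟨ψ.2, trivial⟩, ?_⟩
  rw [zero_smul, sub_zero, (linearization_eq_iff ψ 0 0 0).2 ⟨rfl, by simp [hψ]⟩]
  exact Submodule.zero_mem _

theorem zero_mem_pointSpectrum (hψ : schrodinger hW σ ψ = 0) (hψ0 : (ψ : L2) ≠ 0) :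
    (0 : ℂ) ∈ pointSpectrum (linearization hW hγ σ ε) := by
  refine ⟨⟨((ψ : L2), 0), ⟨ψ.2, trivial⟩⟩, fun h => hψ0 (congrArg Prod.fst h), ?_⟩
  rw [zero_smul, (linearization_eq_iff ψ 0 0 0).2 ⟨rfl, by simp [hψ]⟩]
  rfl

/-- If `⟪ψ, γ ψ⟫ ≠ 0`, no Jordan chain starting at `(ψ, 0)` has length two: the second vector
`(v, ψ)` would satisfy `H v = -ε γ ψ`, and `ψ` is orthogonal to the range of `H`. -/
theorem algMultiplicity_eq_one (hσ : 0 < σ) (hε : ε ≠ 0) (hψ : schrodinger hW σ ψ = 0)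
    (hψ0 : (ψ : L2) ≠ 0) (hne : ⟪(ψ : L2), mulOp hγ (ψ : L2)⟫_ℂ ≠ 0) :
    algMultiplicity (linearization hW hγ σ ε) 0 = 1 := by
  have hli : LinearIndependent ℂ ![((ψ : L2), (0 : L2))] :=
    linearIndependent_unique_iff.2 fun h => hψ0 (congrArg Prod.fst h)
  refine algMultiplicity_eq_of_linearIndependent _ _ hli
    (Fin.forall_fin_one.2 ⟨1, mem_genKer_one hψ⟩) ?_
  rintro ⟨⟨v, w⟩, hv⟩ hx
  rw [zero_smul, sub_zero] at hx
  simp only [Matrix.range_cons, Matrix.range_empty, union_empty,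
    Submodule.mem_span_singleton] at hx ⊢
  obtain ⟨c, hc⟩ := hx
  obtain ⟨hw, hHv⟩ := (linearization_eq_iff ⟨v, hv.1⟩ w (c • (ψ : L2)) 0).1 (by
    rw [← hc, Prod.smul_mk, smul_zero])
  subst hw
  have h1 : ⟪(ψ : L2), schrodinger hW σ ⟨v, hv.1⟩⟫_ℂ = 0 := by
    rw [← inner_schrodinger hW hσ, hψ, inner_zero_left]
  rw [hHv, neg_zero, zero_sub, inner_neg_right, map_smul, inner_smul_right, inner_smul_right,
    neg_eq_zero, mul_eq_zero, mul_eq_zero, or_iff_right (Complex.ofReal_ne_zero.2 hε),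
    or_iff_left hne] at h1
  subst h1
  obtain ⟨d, hd⟩ := exists_eq_smul_of_ker hW (u := ⟨v, hv.1⟩) hψ hψ0 (by simp [hHv])
  exact ⟨d, by rw [Prod.smul_mk, smul_zero, zero_smul, ← hd]⟩

/-- If `H v = γ ψ`, then `(-ε v, ψ)` extends the eigenvector `(ψ, 0)` to a Jordan chain of length
two; a third vector would force `‖ψ‖² = ε² ⟪ψ, γ v⟫`. -/
theorem algMultiplicity_eq_two (hσ : 0 < σ) (hψ : schrodinger hW σ ψ = 0)
    (hψ0 : (ψ : L2) ≠ 0) (h0 : ⟪(ψ : L2), mulOp hγ (ψ : L2)⟫_ℂ = 0)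
    {v : (schrodinger hW σ).domain} (hv : schrodinger hW σ v = mulOp hγ (ψ : L2))
    (hne : ⟪(ψ : L2), (ψ : L2)⟫_ℂ ≠ (ε : ℂ) ^ 2 * ⟪(ψ : L2), mulOp hγ (v : L2)⟫_ℂ) :
    algMultiplicity (linearization hW hγ σ ε) 0 = 2 := by
  have hli : LinearIndependent ℂ ![((ψ : L2), (0 : L2)), (-(ε : ℂ) • (v : L2), (ψ : L2))] := by
    rw [LinearIndependent.pair_iff]
    intro s t h
    have h2 := congrArg Prod.snd h
    have h1 := congrArg Prod.fst h
    simp only [Prod.smul_mk, Prod.mk_add_mk, smul_zero, zero_add, Prod.snd_zero,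
      Prod.fst_zero] at h1 h2
    have ht : t = 0 := (smul_eq_zero.1 h2).resolve_right hψ0
    rw [ht, zero_smul, add_zero] at h1
    exact ⟨(smul_eq_zero.1 h1).resolve_right hψ0, ht⟩
  refine algMultiplicity_eq_of_linearIndependent _ _ hli
    (Fin.forall_fin_two.2 ⟨⟨1, mem_genKer_one hψ⟩, 2, ?_⟩) ?_
  · refine (mem_genKer_succ _ _ _ _).2 ⟨⟨(-(ε : ℂ) • v).2, trivial⟩, ?_⟩
    rw [zero_smul, sub_zero]
    have := (linearization_eq_iff (hγ := hγ) (ε := ε) (-(ε : ℂ) • v) (ψ : L2) (ψ : L2) 0).2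
      ⟨rfl, by rw [LinearPMap.map_smul, hv]; simp⟩
    change linearization hW hγ σ ε ⟨((-(ε : ℂ) • v : (schrodinger hW σ).domain), (ψ : L2)), _⟩ ∈ _
    rw [this]
    exact mem_genKer_one hψ
  rintro ⟨⟨y, w⟩, hy⟩ hx
  rw [zero_smul, sub_zero] at hx
  simp only [Matrix.range_cons, Matrix.range_empty, union_empty, singleton_union,
    Submodule.mem_span_pair] at hx ⊢
  obtain ⟨a, d, hc⟩ := hx
  obtain ⟨hw, hHy⟩ := (linearization_eq_iff ⟨y, hy.1⟩ w
    (a • (ψ : L2) + d • -(ε : ℂ) • (v : L2)) (d • (ψ : L2))).1 (by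
      rw [← hc, Prod.smul_mk, Prod.smul_mk, Prod.mk_add_mk, smul_zero, zero_add])
  subst hw
  have h1 : ⟪(ψ : L2), schrodinger hW σ ⟨y, hy.1⟩⟫_ℂ = 0 := by
    rw [← inner_schrodinger hW hσ, hψ, inner_zero_left]
  simp only [hHy, inner_sub_right, inner_neg_right, map_add, map_smul, inner_smul_right,
    inner_add_right, h0] at h1
  have hd : d = 0 := by
    have : d * (⟪(ψ : L2), (ψ : L2)⟫_ℂ - (ε : ℂ) ^ 2 * ⟪(ψ : L2), mulOp hγ (v : L2)⟫_ℂ) = 0 := by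
      linear_combination -h1
    exact (mul_eq_zero.1 this).resolve_right (sub_ne_zero.2 hne)
  subst hd
  simp only [zero_smul, neg_zero, add_zero, zero_sub, map_smul] at hHy
  obtain ⟨c, hc'⟩ := exists_eq_smul_of_ker hW (u := ⟨y, hy.1⟩ + (a * ε) • v) hψ hψ0 (by
    rw [LinearPMap.map_add, LinearPMap.map_smul, hHy, hv, mul_smul, smul_comm a]
    abel)
  refine ⟨c, a, ?_⟩
  have hc'' : y + (a * (ε : ℂ)) • (v : L2) = c • (ψ : L2) := hc'
  rw [Prod.smul_mk, Prod.smul_mk, Prod.mk_add_mk, smul_zero, zero_add, zero_smul, add_zero,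
    ← hc'', smul_smul, mul_neg, neg_smul, add_neg_cancel_right]

end Linearization

end PTKleinGordon

end
theorem mainTheorem2 (W γ : ℝ → ℝ) (σ : ℝ)
    (hW : PTKleinGordon.ExpLocalized W) (hγ : PTKleinGordon.ExpLocalized γ)
    (hγ_odd : Function.Odd γ) (hσ : 0 < σ)
    (hspec : PTKleinGordon.SpectralAssumption (PTKleinGordon.schrodinger hW σ) σ)
    (ψ₀ : (PTKleinGordon.schrodinger hW σ).domain) (hψ₀ : ψ₀ ≠ 0)
    (hker : PTKleinGordon.schrodinger hW σ ψ₀ = 0) :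
    ∃ ε₀ : ℝ, 0 < ε₀ ∧ ∀ ε : ℝ, 0 < ε → ε < ε₀ →
      (0 : ℂ) ∈ PTKleinGordon.pointSpectrum (PTKleinGordon.linearization hW hγ σ ε) ∧
      ((∫ x : ℝ, (γ x : ℂ) * (ψ₀ : PTKleinGordon.L2) x * (ψ₀ : PTKleinGordon.L2) x) = 0 →
        PTKleinGordon.algMultiplicity (PTKleinGordon.linearization hW hγ σ ε) 0 = 2) ∧
      ((∫ x : ℝ, (γ x : ℂ) * (ψ₀ : PTKleinGordon.L2) x * (ψ₀ : PTKleinGordon.L2) x) ≠ 0 →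
        PTKleinGordon.algMultiplicity (PTKleinGordon.linearization hW hγ σ ε) 0 = 1) := by
  have hψ0 : (ψ₀ : PTKleinGordon.L2) ≠ 0 := fun h => hψ₀ (Subtype.ext h)
  simp only [ne_eq, PTKleinGordon.integral_eq_zero_iff_inner_eq_zero hW hγ hker hψ0]
  by_cases h0 : inner ℂ (ψ₀ : PTKleinGordon.L2)
      (PTKleinGordon.mulOp hγ (ψ₀ : PTKleinGordon.L2)) = 0
  · obtain ⟨v, hv⟩ := PTKleinGordon.exists_schrodinger_eq hW hσ hker hψ0 h0
    set B : ℂ := inner ℂ (ψ₀ : PTKleinGordon.L2)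
      (PTKleinGordon.mulOp hγ (v : PTKleinGordon.L2)) with hB
    have hpos : 0 < ‖(ψ₀ : PTKleinGordon.L2)‖ ^ 2 := by
      have := norm_pos_iff.2 hψ0
      positivity
    refine ⟨min 1 (‖(ψ₀ : PTKleinGordon.L2)‖ ^ 2 / (‖B‖ + 1)), by positivity,
      fun ε hε hlt => ⟨PTKleinGordon.zero_mem_pointSpectrum hker hψ0, fun _ => ?_,
        fun h => absurd h0 h⟩⟩
    refine PTKleinGordon.algMultiplicity_eq_two hσ hker hψ0 h0 hv fun heq => ?_
    -- The threshold is chosen so that `ε² |⟪ψ₀, γ v⟫| ≤ ε |⟪ψ₀, γ v⟫| < ‖ψ₀‖²`.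
    have h1 : ε < 1 := hlt.trans_le (min_le_left _ _)
    have h2 : ε * (‖B‖ + 1) < ‖(ψ₀ : PTKleinGordon.L2)‖ ^ 2 :=
      (lt_div_iff₀ (by positivity)).1 (hlt.trans_le (min_le_right _ _))
    have h3 := congrArg norm heq
    rw [inner_self_eq_norm_sq_to_K, norm_mul, norm_pow, norm_pow, RCLike.norm_ofReal, abs_norm,
      Complex.norm_real, Real.norm_eq_abs, abs_of_pos hε] at h3
    have h4 : ε ^ 2 * ‖B‖ ≤ ε * ‖B‖ :=
      mul_le_mul_of_nonneg_right (by nlinarith) (norm_nonneg B)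
    linarith
  · exact ⟨1, one_pos, fun ε hε _ => ⟨PTKleinGordon.zero_mem_pointSpectrum hker hψ0,
      fun h => absurd h h0,
      fun _ => PTKleinGordon.algMultiplicity_eq_one hσ hε.ne' hker hψ0 h0⟩⟩
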